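/- Let $m,n\ge 0$ be integers. The Aztec rectangle $AR_{m,n}$, with $m$ unit squares on its southwest side and $n$ unit squares on its southeast side, is the union of all unit squares $[i,i+1]\times[j,j+1]$ ($i,j\in\mathbb Z$) contained in the tilted rectangle $0\le x+y\le 2(n+1)$, $0\le x-y\le 2(m+1)$. The mixed Aztec rectangle $MR_{m,n}$ is $AR_{m,n}$ with the $m$ unit squares along its southwest side ($i+j=0$) and the $n$ unit squares along its southeast side ($i-j=2m+1$) removed. Color the unit squares in checkerboard fashion so that those along the northeast side ($i+j=2n$) are black, i.e. the square $[i,i+1]\times[j,j+1]$ is black if $i+j$ is even and white if $i+j$ is odd. Theorem. Let $a,c\ge 1$ and $b\ge 0$ be integers. Suppose that four unit squares of $MR_{m,n}$ lie in a common horizontal row, are colored white, white, black, black from left to right, and have exactly $2a-1$, $2b$ and $2c-1$ unit squares strictly between consecutive ones (from left to right). Let $MR_{m,n}(a,b,c)$ be $MR_{m,n}$ with these four unit squares removed, and let $\mathrm{M}(R)$ denote the number of domino tilings of a region $R$. Then $$\mathrm{M}(MR_{m,n}(a,b,c)) = 2\,d_{b,b}\sum_{i=1}^{a}\sum_{j=1}^{c}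 r_{b+i+j-1}\,d_{a-i,a-i}\,d_{c-j,c-j},$$ where $d_{n,k}$ is the Delannoy number, given by $d_{n,0}=d_{0,k}=1$ and $d_{n,k}=d_{n-1,k-1}+d_{n-1,k}+d_{n,k-1}$ for $n,k\ge1$, and $r_n$ is the large Schröder number, given by $r_0=1$ and $r_{n+1}=r_n+\sum_{i=0}^{n} r_i r_{n-i}$. In particular, $\mathrm{M}(MR_{m,n}(a,b,c))$ depends only on $a,b,c$, and not on $m$, $n$ or the position of the leftmost hole. -/

import Mathlib

/-- A unit square of the square lattice: `(i, j)` stands for `[i, i + 1] × [j, j + 1]`. -/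
abbrev Cell : Type := ℤ × ℤ

/-- The checkerboard colouring: a cell is black when `i + j` is even, white otherwise. -/
def IsBlack (p : Cell) : Prop := Even (p.1 + p.2)

/-- The white cells of the checkerboard colouring. -/
def IsWhite (p : Cell) : Prop := ¬ IsBlack p

/-- The Aztec rectangle with `m` unit squares on its southwest side and `n` unit squares on its
southeast side: all unit squares `[i, i + 1] × [j, j + 1]` contained in the tilted rectangle
`0 ≤ x + y ≤ 2 * (n + 1)`, `0 ≤ x - y ≤ 2 * (m + 1)`. On such a square `x + y` ranges over
`[i + j, i + j + 2]` and `x - y` over `[i - j - 1, i - j + 1]`. For `m = n` this is the Aztec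
diamond `|x| + |y| ≤ n + 1`, translated so that its leftmost corner is the origin. -/
def aztecRectangle (m n : ℕ) : Set Cell :=
  {p | 0 ≤ p.1 + p.2 ∧ p.1 + p.2 + 2 ≤ 2 * ((n : ℤ) + 1) ∧
       0 ≤ p.1 - p.2 - 1 ∧ p.1 - p.2 + 1 ≤ 2 * ((m : ℤ) + 1)}

/-- The `m` unit squares along the southwest side of the Aztec rectangle. -/
def southwestSquares (m n : ℕ) : Set Cell :=
  {p ∈ aztecRectangle m n | p.1 + p.2 = 0}

/-- The `n` unit squares along the southeast side of the Aztec rectangle. -/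
def southeastSquares (m n : ℕ) : Set Cell :=
  {p ∈ aztecRectangle m n | p.1 - p.2 + 1 = 2 * ((m : ℤ) + 1)}

/-- The mixed Aztec rectangle: the Aztec rectangle without its southwest `m` unit squares and its
southeast `n` unit squares. The unit squares along its northeast side (`i + j = 2 * n`) are
black. -/
def mixedAztecRectangle (m n : ℕ) : Set Cell :=
  aztecRectangle m n \ (southwestSquares m n ∪ southeastSquares m n)

/-- Four unit squares on a common horizontal line, the leftmost one being `p`, with (from left to
right) `2 * a - 1`, `2 * b` and `2 * c - 1` unit squares strictly between consecutive ones (here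
`a` and `c` are positive). -/
def fourHoles (a b c : ℕ) (p : Cell) : Set Cell :=
  {p,
   (p.1 + 2 * a, p.2),
   (p.1 + 2 * a + (2 * b + 1), p.2),
   (p.1 + 2 * a + (2 * b + 1) + 2 * c, p.2)}

/-- `p` is an admissible position of the leftmost hole: the four holes lie inside the mixed Aztec
rectangle and are coloured white, white, black, black from left to right. -/
structure IsAdmissible (m n a b c : ℕ) (p : Cell) : Prop where
  inside : fourHoles a b c p ⊆ mixedAztecRectangle m n
  white₁ : IsWhite p
  white₂ : IsWhite (p.1 + 2 * a, p.2)
  black₁ : IsBlack (p.1 + 2 * a + (2 * b + 1), p.2)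
  black₂ : IsBlack (p.1 + 2 * a + (2 * b + 1) + 2 * c, p.2)

/-- The mixed Aztec rectangle with the four unit holes removed. -/
def holeyMixedAztecRectangle (m n a b c : ℕ) (p : Cell) : Set Cell :=
  mixedAztecRectangle m n \ fourHoles a b c p

/-- A domino: the union of two unit squares sharing an edge. -/
def IsDomino (D : Finset Cell) : Prop :=
  ∃ i j : ℤ, D = {(i, j), (i + 1, j)} ∨ D = {(i, j), (i, j + 1)}

/-- `T` is a domino tiling of the region `R`: the members of `T` are dominoes contained in `R`, and
every unit square of `R` belongs to exactly one of them. -/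
structure IsDominoTiling (R : Set Cell) (T : Set (Finset Cell)) : Prop where
  isDomino : ∀ D ∈ T, IsDomino D
  subset : ∀ D ∈ T, (D : Set Cell) ⊆ R
  existsUnique : ∀ p ∈ R, ∃! D, D ∈ T ∧ p ∈ D

/-- The number of domino tilings of a region. -/
noncomputable def numDominoTilings (R : Set Cell) : ℕ :=
  {T : Set (Finset Cell) | IsDominoTiling R T}.ncard

/-- The Delannoy number `d_{n,k}`: the number of lattice paths from `(0, 0)` to `(n, k)` with steps
`(1, 0)`, `(0, 1)` and `(1, 1)`. -/
def delannoy : ℕ → ℕ → ℕ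
  | _, 0 => 1
  | 0, _ + 1 => 1
  | n + 1, k + 1 => delannoy n k + delannoy n (k + 1) + delannoy (n + 1) k

/-! In rotated coordinates the white and the black cells of the mixed rectangle are both indexed by
the grid `[1, n] × [1, m]`, and a white cell `x` borders the black cells `x`, `x - (1, 0)`, `x - (0,
1)`, `x - (1, 1)`. Without holes the only tiling pairs white `x` with black `x`; relative to it, a
tiling with holes is a set of disjoint Delannoy paths from the white holes to the black ones. The
four holes become points `u`, `v = u + (a, a)`, `s = v + (b, b)`, `e = s + (c, c)` of one diagonal.

Either start can be joined to either end, so the usual determinant of path counts does not apply.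
Instead, the entry for `e` is replaced by `signedHits`: paths to `e` whose first visit to the
diagonal comes after `s`, signed by the side they start on. Up to the level of `s` it obeys the
Delannoy recursion even across the diagonal, and the resulting determinant `pathPairs` counts
disjoint pairs when one start is northwest of the other (`numDominoTilings_latticeRegion_pair`).

Now let the path from `u` run until it is level with `v` or straight below it. As `v` lies on the
diagonal, its signed entry vanishes, so the determinant is `delannoy b b` times a count of single
paths. Hence the number of tilings is `delannoy b b` times the number of Delannoy paths from `u` to
`e` avoiding the diagonal from `v` to `s` (`numDominoTilings_latticeRegion_diagonal`). Such a path
last meets the diagonal before `v` at `v - (i, i)`, leaves it on one of two sides, and returns first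
at `s + (j, j)`; the excursion between is counted by a large Schröder number. -/

/-! ### First hits of the diagonal and large Schröder numbers. -/

/-- The number of lattice paths with steps `(1, 0)`, `(0, 1)`, `(1, 1)` from a point at height `g`
above the diagonal to a point of the diagonal, `q` being the vertical distance to go, that meet
the diagonal only at the end. -/
def diagonalHits : ℕ → ℕ → ℕ
  | 0, 0 => 1
  | 0, _ + 1 => 0
  | g + 1, 0 => diagonalHits g 0
  | g + 1, q + 1 => diagonalHits g (q + 1) + diagonalHits (g + 2) q + diagonalHits (g + 1) q
termination_by g q => (q, g)

theorem diagonalHits_zero_right (g : ℕ) : diagonalHits g 0 = 1 := by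
  induction g with
  | zero => simp [diagonalHits]
  | succ g ih => rw [diagonalHits, ih]

/-- The first-hit decomposition of a function satisfying the Delannoy recursion off the
diagonal. -/
theorem eq_sum_diagonalHits (f : ℕ → ℕ → ℕ) (h0 : ∀ g, f (g + 1) 0 = f g 0)
    (h1 : ∀ g q, f (g + 1) (q + 1) = f g (q + 1) + f (g + 2) q + f (g + 1) q) (g q : ℕ) :
    f g q = ∑ x ∈ Finset.HasAntidiagonal.antidiagonal q, diagonalHits g x.1 * f 0 x.2 := by
  induction q generalizing g with
  | zero =>
    simp only [Finset.Nat.antidiagonal_zero, Finset.sum_singleton, diagonalHits_zero_right, one_mul]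
    induction g with
    | zero => rfl
    | succ g ih => rw [h0, ih]
  | succ q ihq =>
    induction g with
    | zero =>
      rw [Finset.Nat.sum_antidiagonal_succ]
      simp [diagonalHits]
    | succ g ihg =>
      rw [h1, ihg, ihq, ihq]
      simp only [Finset.Nat.sum_antidiagonal_succ, diagonalHits, diagonalHits_zero_right, add_mul,
        Finset.sum_add_distrib]
      ring

theorem diagonalHits_one (n : ℕ) : diagonalHits 1 n = Nat.largeSchroder n := by
  induction n using Nat.strong_induction_on with
  | _ n ih =>
    cases n with
    | zero => simp [diagonalHits]
    | succ n =>
      -- From height 2 the path must first come down to height 1, so the first-hit decomposition is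
      -- applied with the line at height 1 as diagonal; this yields the Schröder convolution.
      have key := eq_sum_diagonalHits (fun g q => diagonalHits (g + 1) q)
        (fun g => by rw [diagonalHits]) (fun g q => by rw [diagonalHits]) 1 n
      rw [Nat.largeSchroder, diagonalHits, diagonalHits, key, ih n (by omega)]
      simp only [zero_add]
      rw [Finset.Nat.sum_antidiagonal_eq_sum_range_succ_mk, Fin.sum_univ_eq_sum_range
        (fun i => Nat.largeSchroder i * Nat.largeSchroder (n - i))]
      rw [add_comm]
      congr 1
      refine Finset.sum_congr rfl fun i hi => ?_
      rw [Finset.mem_range] at hi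
      rw [ih i (by omega), ih (n - i) (by omega)]

/-! ### Delannoy numbers and paths that meet the diagonal late. -/

theorem delannoy_zero_left (k : ℕ) : delannoy 0 k = 1 := by
  cases k <;> simp [delannoy]

theorem delannoy_zero_right (n : ℕ) : delannoy n 0 = 1 := by
  cases n <;> simp [delannoy]

theorem delannoy_succ_succ (n k : ℕ) :
    delannoy (n + 1) (k + 1) = delannoy n k + delannoy n (k + 1) + delannoy (n + 1) k := by
  rw [delannoy]

theorem delannoy_comm (n k : ℕ) : delannoy n k = delannoy k n := by
  induction n generalizing k with
  | zero => rw [delannoy_zero_left, delannoy_zero_right]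
  | succ n ih =>
    induction k with
    | zero => rw [delannoy_zero_left, delannoy_zero_right]
    | succ k ihk => rw [delannoy_succ_succ, delannoy_succ_succ, ih, ih, ihk]; ring

theorem delannoy_eq_sum_diagonalHits (g q : ℕ) :
    delannoy (g + q) q =
      ∑ x ∈ Finset.HasAntidiagonal.antidiagonal q, diagonalHits g x.1 * delannoy x.2 x.2 := by
  have := eq_sum_diagonalHits (fun g q => delannoy (g + q) q)
    (fun g => by simp [delannoy_zero_right])
    (fun g q => by
      rw [show g + 1 + (q + 1) = (g + q + 1) + 1 by ring, delannoy_succ_succ,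
        show g + (q + 1) = g + q + 1 by ring, show g + 2 + q = g + q + 1 + 1 by ring,
        show g + 1 + q = g + q + 1 by ring]
      ring) g q
  simpa using this

/-- The number of lattice paths as in `diagonalHits`, continued from the first point on the
diagonal to the point where the diagonal ends, such that this first point has distance less than
`c` from the end. -/
def lateHits (c g q : ℕ) : ℕ :=
  ∑ x ∈ Finset.HasAntidiagonal.antidiagonal q,
    diagonalHits g x.1 * if x.2 < c then delannoy x.2 x.2 else 0

theorem lateHits_zero_left (c q : ℕ) :
    lateHits c 0 q = if q < c then delannoy q q else 0 := by
  unfold lateHits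
  cases q with
  | zero => simp [diagonalHits]
  | succ q => rw [Finset.Nat.sum_antidiagonal_succ]; simp [diagonalHits]

theorem lateHits_succ_zero (c g : ℕ) : lateHits c (g + 1) 0 = lateHits c g 0 := by
  simp [lateHits, diagonalHits]

theorem lateHits_succ_succ (c g q : ℕ) :
    lateHits c (g + 1) (q + 1) =
      lateHits c g (q + 1) + lateHits c (g + 2) q + lateHits c (g + 1) q := by
  simp only [lateHits, Finset.Nat.sum_antidiagonal_succ, diagonalHits, diagonalHits_zero_right,
    add_mul, Finset.sum_add_distrib]
  ring

/-- A start at vertical distance less than `c` makes every first hit late, so no path is excluded.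
-/
theorem lateHits_of_lt {c g q : ℕ} (h : q < c) : lateHits c g q = delannoy (g + q) q := by
  rw [delannoy_eq_sum_diagonalHits, lateHits]
  refine Finset.sum_congr rfl fun x hx => ?_
  rw [Finset.HasAntidiagonal.mem_antidiagonal] at hx
  rw [if_pos (by omega)]

/-- The index `j` records a first hit at distance `c - j` from the end; from height 1 the part
before it is a Schröder number. -/
theorem lateHits_one (b c i : ℕ) (hi : 1 ≤ i) :
    lateHits c 1 (b + c + i - 1) =
      ∑ j ∈ Finset.Icc 1 c, Nat.largeSchroder (b + i + j - 1) * delannoy (c - j) (c - j) := by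
  simp only [lateHits, mul_ite, mul_zero, ← Finset.sum_filter, diagonalHits_one]
  refine Finset.sum_bij' (fun x _ => c - x.2) (fun j _ => (b + i + j - 1, c - j)) ?_ ?_ ?_ ?_ ?_
  · intro x hx
    simp only [Finset.mem_filter, Finset.HasAntidiagonal.mem_antidiagonal, Finset.mem_Icc] at hx ⊢
    omega
  · intro x hx
    simp only [Finset.mem_filter, Finset.HasAntidiagonal.mem_antidiagonal, Finset.mem_Icc] at hx ⊢
    omega
  · intro x hx
    simp only [Finset.mem_filter, Finset.HasAntidiagonal.mem_antidiagonal] at hx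
    ext <;> simp only <;> omega
  · intro x hx
    simp only [Finset.mem_Icc] at hx
    omega
  · intro x hx
    simp only [Finset.mem_filter, Finset.HasAntidiagonal.mem_antidiagonal] at hx
    rw [show b + i + (c - x.2) - 1 = x.1 by omega, show c - (c - x.2) = x.2 by omega]

/-! ### Extension to integer distances. -/

/-- The Delannoy numbers extended by zero to all pairs of integers. -/
def delannoyInt (p q : ℤ) : ℤ :=
  if 0 ≤ p ∧ 0 ≤ q then delannoy p.toNat q.toNat else 0

theorem delannoyInt_eq_zero {p q : ℤ} (h : ¬ (0 ≤ p ∧ 0 ≤ q)) : delannoyInt p q = 0 := if_neg h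

theorem delannoyInt_natCast (n k : ℕ) : delannoyInt n k = delannoy n k := by
  simp [delannoyInt]

theorem delannoyInt_zero_zero : delannoyInt 0 0 = 1 := by
  simp [delannoyInt, delannoy_zero_right]

theorem delannoyInt_comm (p q : ℤ) : delannoyInt p q = delannoyInt q p := by
  unfold delannoyInt
  rw [delannoy_comm]
  exact if_congr and_comm rfl rfl

theorem delannoyInt_rec {p q : ℤ} (h : ¬ (p = 0 ∧ q = 0)) :
    delannoyInt p q =
      delannoyInt (p - 1) q + delannoyInt p (q - 1) + delannoyInt (p - 1) (q - 1) := by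
  by_cases hpq : 0 ≤ p ∧ 0 ≤ q
  · obtain ⟨n, rfl⟩ := Int.eq_ofNat_of_zero_le hpq.1
    obtain ⟨k, rfl⟩ := Int.eq_ofNat_of_zero_le hpq.2
    rcases n with _ | n <;> rcases k with _ | k
    · simp at h
    · have e : ((k + 1 : ℕ) : ℤ) - 1 = k := by push_cast; ring
      rw [delannoyInt_eq_zero (p := ((0 : ℕ) : ℤ) - 1) (by simp),
        delannoyInt_eq_zero (p := ((0 : ℕ) : ℤ) - 1) (by simp), e, delannoyInt_natCast,
        delannoyInt_natCast, delannoy_zero_left, delannoy_zero_left]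
      simp
    · have e : ((n + 1 : ℕ) : ℤ) - 1 = n := by push_cast; ring
      rw [delannoyInt_eq_zero (q := ((0 : ℕ) : ℤ) - 1) (by simp),
        delannoyInt_eq_zero (q := ((0 : ℕ) : ℤ) - 1) (by simp), e, delannoyInt_natCast,
        delannoyInt_natCast, delannoy_zero_right, delannoy_zero_right]
      simp
    · have e : ((n + 1 : ℕ) : ℤ) - 1 = n := by push_cast; ring
      have e' : ((k + 1 : ℕ) : ℤ) - 1 = k := by push_cast; ring
      rw [e, e']
      simp only [delannoyInt_natCast, delannoy_succ_succ]
      push_cast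
      ring
  · rw [delannoyInt_eq_zero hpq, delannoyInt_eq_zero (by omega), delannoyInt_eq_zero (by omega),
      delannoyInt_eq_zero (by omega)]
    simp

/-- The numbers `lateHits` as a symmetric function of the horizontal and the vertical distance to
the end of the diagonal. -/
def lateHitsInt (c : ℕ) (p q : ℤ) : ℤ :=
  if 0 ≤ min p q then lateHits c (p - q).natAbs (min p q).toNat else 0

theorem lateHitsInt_comm (c : ℕ) (p q : ℤ) : lateHitsInt c p q = lateHitsInt c q p := by
  unfold lateHitsInt
  rw [min_comm, ← Int.natAbs_neg, neg_sub]

theorem lateHitsInt_eq_zero (c : ℕ) {p q : ℤ} (h : ¬ (0 ≤ p ∧ 0 ≤ q)) :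
    lateHitsInt c p q = 0 := by
  rw [lateHitsInt, if_neg (by omega)]

theorem lateHitsInt_natCast (c g q : ℕ) :
    lateHitsInt c ((g : ℤ) + q) q = lateHits c g q := by
  rw [lateHitsInt, if_pos (by omega)]
  congr 2 <;> omega

theorem lateHitsInt_self (c : ℕ) (p : ℤ) (h : (c : ℤ) ≤ p) : lateHitsInt c p p = 0 := by
  obtain ⟨n, rfl⟩ := Int.eq_ofNat_of_zero_le (by omega : 0 ≤ p)
  have := lateHitsInt_natCast c 0 n
  simp only [Nat.cast_zero, zero_add] at this
  rw [this, lateHits_zero_left, if_neg (by omega), Nat.cast_zero]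

theorem lateHitsInt_of_lt {c : ℕ} {p q : ℤ} (hqp : q ≤ p) (h : q < c) :
    lateHitsInt c p q = delannoyInt p q := by
  by_cases hq : 0 ≤ q
  · obtain ⟨n, rfl⟩ := Int.eq_ofNat_of_zero_le hq
    obtain ⟨g, hg⟩ := Int.eq_ofNat_of_zero_le (sub_nonneg.2 hqp)
    obtain rfl : p = g + n := by omega
    rw [lateHitsInt_natCast, lateHits_of_lt (by omega), ← Nat.cast_add, delannoyInt_natCast]
  · rw [lateHitsInt_eq_zero _ (by omega), delannoyInt_eq_zero (by omega)]

theorem lateHitsInt_rec (c : ℕ) {p q : ℤ} (h : q < p) :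
    lateHitsInt c p q =
      lateHitsInt c (p - 1) q + lateHitsInt c p (q - 1) + lateHitsInt c (p - 1) (q - 1) := by
  by_cases hq : 0 ≤ q
  · obtain ⟨n, rfl⟩ := Int.eq_ofNat_of_zero_le hq
    obtain ⟨g, hg⟩ := Int.eq_ofNat_of_zero_le (by omega : 0 ≤ p - n - 1)
    obtain rfl : p = ((g + 1 : ℕ) : ℤ) + n := by push_cast; omega
    rw [show ((g + 1 : ℕ) : ℤ) + n - 1 = (g : ℤ) + n by push_cast; ring, lateHitsInt_natCast,
      lateHitsInt_natCast]
    cases n with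
    | zero =>
      rw [lateHitsInt_eq_zero _ (by simp), lateHitsInt_eq_zero _ (by simp), lateHits_succ_zero]
      simp
    | succ n =>
      rw [show ((g + 1 : ℕ) : ℤ) + (n + 1 : ℕ) = ((g + 2 : ℕ) : ℤ) + n by push_cast; ring,
        show (g : ℤ) + (n + 1 : ℕ) = ((g + 1 : ℕ) : ℤ) + n by push_cast; ring,
        show ((n + 1 : ℕ) : ℤ) - 1 = n by push_cast; ring, lateHitsInt_natCast,
        lateHitsInt_natCast, lateHits_succ_succ]
      push_cast
      ring
  · rw [lateHitsInt_eq_zero _ (by omega), lateHitsInt_eq_zero _ (by omega),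
      lateHitsInt_eq_zero _ (by omega), lateHitsInt_eq_zero _ (by omega)]
    simp

/-! ### Signed path counts. -/

/-- The antisymmetric variant of `lateHitsInt`. -/
def signedHits (c : ℕ) (p q : ℤ) : ℤ := (p - q).sign * lateHitsInt c p q

theorem signedHits_swap (c : ℕ) (p q : ℤ) : signedHits c p q = -signedHits c q p := by
  rw [signedHits, signedHits, lateHitsInt_comm, ← neg_sub q p, Int.sign_neg]
  ring

theorem signedHits_of_lt (c : ℕ) {p q : ℤ} (h : q < p) :
    signedHits c p q = lateHitsInt c p q := by
  rw [signedHits, Int.sign_eq_one_of_pos (by omega), one_mul]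

theorem signedHits_of_gt (c : ℕ) {p q : ℤ} (h : p < q) :
    signedHits c p q = -lateHitsInt c p q := by
  rw [signedHits, Int.sign_eq_neg_one_of_neg (by omega), neg_one_mul]

theorem signedHits_self (c : ℕ) (p : ℤ) : signedHits c p p = 0 := by
  simp [signedHits]

theorem signedHits_eq_zero (c : ℕ) {p q : ℤ} (h : ¬ (0 ≤ p ∧ 0 ≤ q)) :
    signedHits c p q = 0 := by
  rw [signedHits, lateHitsInt_eq_zero c h, mul_zero]

theorem signedHits_of_le (c : ℕ) {p q : ℤ} (hqp : q ≤ p) (h : 2 * (c : ℤ) ≤ p + q + 1) :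
    signedHits c p q = lateHitsInt c p q := by
  rcases hqp.lt_or_eq with hlt | rfl
  · exact signedHits_of_lt c hlt
  · rw [signedHits_self, lateHitsInt_self c _ (by omega)]

theorem signedHits_rec_of_lt (c : ℕ) {p q : ℤ} (hqp : q < p) (h : 2 * (c : ℤ) ≤ p + q) :
    signedHits c p q =
      signedHits c (p - 1) q + signedHits c p (q - 1) + signedHits c (p - 1) (q - 1) := by
  rw [signedHits_of_lt c hqp, signedHits_of_le c (p := p - 1) (by omega) (by omega),
    signedHits_of_lt c (p := p) (by omega), signedHits_of_lt c (p := p - 1) (by omega),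
    lateHitsInt_rec c hqp]

/-- On the diagonal the two neighbours are mirror images and cancel by antisymmetry. Just off it,
the recursion involves a diagonal point at distance at least `c`, where both `lateHitsInt` and
`signedHits` vanish; this is what the bound on `p + q` ensures. -/
theorem signedHits_rec (c : ℕ) {p q : ℤ} (h : 2 * (c : ℤ) ≤ p + q) :
    signedHits c p q =
      signedHits c (p - 1) q + signedHits c p (q - 1) + signedHits c (p - 1) (q - 1) := by
  rcases lt_trichotomy q p with hlt | rfl | hlt
  · exact signedHits_rec_of_lt c hlt h
  · rw [signedHits_swap c (q - 1), signedHits_self, signedHits_self]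
    ring
  · rw [signedHits_swap, signedHits_rec_of_lt c hlt (by omega), signedHits_swap c (p - 1) q,
      signedHits_swap c p, signedHits_swap c (p - 1)]
    ring

/-! ### Paths avoiding a segment of the diagonal. -/

/-- The number of lattice paths to the end of the diagonal, in terms of the horizontal and vertical
distances to go, that avoid the points of the diagonal at distances `c`, …, `b + c` from the end;
valid for starting points at horizontal and vertical distance at least `b + c`. -/
def avoidingPaths (a b c : ℕ) (p q : ℤ) : ℤ :=
  lateHitsInt c p q + ∑ i ∈ Finset.Icc 1 a,
    2 * delannoyInt (p - b - c - i) (q - b - c - i) * lateHits c 1 (b + c + i - 1)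

theorem avoidingPaths_of_not_lt (a b c : ℕ) {p q : ℤ}
    (h : ¬ ((b : ℤ) + c < p ∧ (b : ℤ) + c < q)) : avoidingPaths a b c p q = lateHitsInt c p q := by
  rw [avoidingPaths, Finset.sum_eq_zero, add_zero]
  intro i hi
  rw [Finset.mem_Icc] at hi
  rw [delannoyInt_eq_zero (by omega)]
  ring

theorem avoidingPaths_rec_of_ne (a b c : ℕ) {p q : ℤ} (h : p ≠ q) :
    avoidingPaths a b c p q = avoidingPaths a b c (p - 1) q + avoidingPaths a b c p (q - 1) +
      avoidingPaths a b c (p - 1) (q - 1) := by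
  have h1 : lateHitsInt c p q =
      lateHitsInt c (p - 1) q + lateHitsInt c p (q - 1) + lateHitsInt c (p - 1) (q - 1) := by
    rcases h.lt_or_gt with hlt | hlt
    · rw [lateHitsInt_comm, lateHitsInt_rec c hlt, lateHitsInt_comm c q, lateHitsInt_comm c (q - 1),
        lateHitsInt_comm c (q - 1)]
      ring
    · exact lateHitsInt_rec c hlt
  simp only [avoidingPaths]
  rw [h1]
  have h2 : ∀ i : ℕ, delannoyInt (p - b - c - i) (q - b - c - i) =
      delannoyInt (p - 1 - b - c - i) (q - b - c - i) +
      delannoyInt (p - b - c - i) (q - 1 - b - c - i) +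
      delannoyInt (p - 1 - b - c - i) (q - 1 - b - c - i) := fun i => by
    rw [delannoyInt_rec (by omega)]
    congr 2 <;> ring_nf
  simp only [h2, mul_add, add_mul, Finset.sum_add_distrib]
  ring

/-- Off the diagonal each summand obeys the recursion. At the diagonal point with `p = b + c + k`
two defects compensate: `lateHitsInt` is zero there although its two neighbours are not, and the
Delannoy factor of index `k` starts from 1 at its origin. The bound on `p` ensures that the term `k`
occurs in the sum. -/
theorem avoidingPaths_rec_self (a b c : ℕ) {p : ℤ} (h : (b : ℤ) + c < p) (h' : p ≤ a + b + c) :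
    avoidingPaths a b c p p = avoidingPaths a b c (p - 1) p + avoidingPaths a b c p (p - 1) +
      avoidingPaths a b c (p - 1) (p - 1) := by
  obtain ⟨k, hk⟩ := Int.eq_ofNat_of_zero_le (by omega : 0 ≤ p - b - c)
  have hmem : k ∈ Finset.Icc 1 a := by rw [Finset.mem_Icc]; omega
  simp only [avoidingPaths]
  have h1 : lateHitsInt c p (p - 1) = lateHits c 1 (b + c + k - 1) := by
    rw [← lateHitsInt_natCast]
    congr 1 <;> omega
  rw [lateHitsInt_comm c (p - 1), lateHitsInt_self c p (by omega), h1,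
    lateHitsInt_self c (p - 1) (by omega), ← Finset.add_sum_erase _ _ hmem,
    ← Finset.add_sum_erase _ _ hmem, ← Finset.add_sum_erase _ _ hmem,
    ← Finset.add_sum_erase _ _ hmem]
  have h2 : ∀ i ∈ (Finset.Icc 1 a).erase k, delannoyInt (p - b - c - i) (p - b - c - i) =
      delannoyInt (p - 1 - b - c - i) (p - b - c - i) +
      delannoyInt (p - b - c - i) (p - 1 - b - c - i) +
      delannoyInt (p - 1 - b - c - i) (p - 1 - b - c - i) := fun i hi => by
    rw [Finset.mem_erase] at hi
    rw [delannoyInt_rec (by omega)]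
    congr 2 <;> ring_nf
  rw [Finset.sum_congr rfl fun i hi => by rw [h2 i hi]]
  have h3 : delannoyInt (p - b - c - k) (p - b - c - k) = 1 := by
    rw [show p - b - c - k = ((0 : ℕ) : ℤ) by omega, delannoyInt_natCast, delannoy_zero_right, Nat.cast_one]
  rw [h3, delannoyInt_eq_zero (p := p - 1 - b - c - k) (by omega),
    delannoyInt_eq_zero (q := p - 1 - b - c - k) (by omega),
    delannoyInt_eq_zero (q := p - 1 - b - c - k) (by omega)]
  simp only [mul_add, add_mul, Finset.sum_add_distrib]
  ring

theorem avoidingPaths_rec (a b c : ℕ) {p q : ℤ} (hp : (b : ℤ) + c < p) (hpa : p ≤ a + b + c) :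
    avoidingPaths a b c p q = avoidingPaths a b c (p - 1) q + avoidingPaths a b c p (q - 1) +
      avoidingPaths a b c (p - 1) (q - 1) := by
  by_cases h : p = q
  · subst h
    exact avoidingPaths_rec_self a b c hp hpa
  · exact avoidingPaths_rec_of_ne a b c h

theorem avoidingPaths_natCast (a b c : ℕ) :
    avoidingPaths a b c ((a + b + c : ℕ) : ℤ) ((a + b + c : ℕ) : ℤ) =
      2 * ∑ i ∈ Finset.Icc 1 a, ∑ j ∈ Finset.Icc 1 c,
        (Nat.largeSchroder (b + i + j - 1) * delannoy (a - i) (a - i) *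
          delannoy (c - j) (c - j) : ℕ) := by
  rw [avoidingPaths, lateHitsInt_self c _ (by omega), zero_add, Nat.cast_sum, Finset.mul_sum]
  refine Finset.sum_congr rfl fun i hi => ?_
  rw [Finset.mem_Icc] at hi
  rw [lateHits_one b c i hi.1,
    show ((a + b + c : ℕ) : ℤ) - b - c - i = ((a - i : ℕ) : ℤ) by omega, delannoyInt_natCast]
  push_cast
  rw [Finset.mul_sum, Finset.mul_sum]
  refine Finset.sum_congr rfl fun j _ => ?_
  ring

/-! ### Domino tilings and expansion at one cell. -/

theorem finite_setOf_isDominoTiling {R : Set Cell} (hR : R.Finite) :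
    {T : Set (Finset Cell) | IsDominoTiling R T}.Finite := by
  have h : {D : Finset Cell | (D : Set Cell) ⊆ R}.Finite := by
    refine Set.Finite.of_finite_image (f := fun D : Finset Cell => (D : Set Cell)) ?_
      Finset.coe_injective.injOn
    exact hR.finite_subsets.subset (by rintro _ ⟨D, hD, rfl⟩; exact hD)
  exact h.finite_subsets.subset fun T hT D hD => hT.subset D hD

theorem numDominoTilings_empty : numDominoTilings ∅ = 1 := by
  rw [numDominoTilings, Set.ncard_eq_one]
  refine ⟨∅, Set.ext fun T => ⟨fun hT => ?_, ?_⟩⟩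
  · rw [Set.mem_singleton_iff, Set.eq_empty_iff_forall_notMem]
    intro D hD
    obtain ⟨i, j, rfl | rfl⟩ := hT.isDomino D hD <;>
    · have := hT.subset _ hD (show (i, j) ∈ _ by simp)
      simp at this
  · rintro rfl
    exact ⟨by simp, by simp, by simp⟩

/-- The cells sharing an edge with a given cell. -/
def neighbors (p : Cell) : Finset Cell :=
  {(p.1 + 1, p.2), (p.1 - 1, p.2), (p.1, p.2 + 1), (p.1, p.2 - 1)}

theorem isDomino_pair {p q : Cell} (h : q ∈ neighbors p) : IsDomino {p, q} := by
  simp only [neighbors, Finset.mem_insert, Finset.mem_singleton] at h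
  obtain ⟨i, j⟩ := p
  rcases h with rfl | rfl | rfl | rfl
  · exact ⟨i, j, Or.inl rfl⟩
  · refine ⟨i - 1, j, Or.inl ?_⟩
    rw [Finset.pair_comm]
    simp
  · exact ⟨i, j, Or.inr rfl⟩
  · refine ⟨i, j - 1, Or.inr ?_⟩
    rw [Finset.pair_comm]
    simp

theorem IsDomino.exists_neighbor {D : Finset Cell} (hD : IsDomino D) {p : Cell} (hp : p ∈ D) :
    ∃ q ∈ neighbors p, D = {p, q} := by
  obtain ⟨i, j, rfl | rfl⟩ := hD <;>
  · simp only [Finset.mem_insert, Finset.mem_singleton] at hp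
    rcases hp with rfl | rfl
    · exact ⟨_, by simp [neighbors], rfl⟩
    · exact ⟨(i, j), by simp [neighbors], Finset.pair_comm _ _⟩

theorem ne_of_mem_neighbors {p q : Cell} (h : q ∈ neighbors p) : q ≠ p := by
  rintro rfl
  simp only [neighbors, Finset.mem_insert, Finset.mem_singleton, Prod.ext_iff] at h
  omega

theorem IsDominoTiling.eq_of_mem {R : Set Cell} {T : Set (Finset Cell)} (hT : IsDominoTiling R T)
    {D D' : Finset Cell} (hD : D ∈ T) (hD' : D' ∈ T) {p : Cell} (hp : p ∈ D) (hp' : p ∈ D') :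
    D = D' :=
  (hT.existsUnique p (hT.subset D hD hp)).unique ⟨hD, hp⟩ ⟨hD', hp'⟩

theorem IsDominoTiling.insert_pair {R : Set Cell} {p q : Cell} (hp : p ∈ R) (hq : q ∈ R)
    (hpq : q ∈ neighbors p) {T : Set (Finset Cell)} (hT : IsDominoTiling (R \ {p, q}) T) :
    IsDominoTiling R (insert {p, q} T) := by
  refine ⟨?_, ?_, ?_⟩
  · rintro D (rfl | hD)
    · exact isDomino_pair hpq
    · exact hT.isDomino D hD
  · rintro D (rfl | hD)
    · rw [Finset.coe_pair]
      exact Set.pair_subset hp hq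
    · exact (hT.subset D hD).trans Set.sdiff_subset
  · intro z hz
    by_cases hzpq : z ∈ ({p, q} : Finset Cell)
    · refine ⟨{p, q}, ⟨Set.mem_insert _ _, hzpq⟩, ?_⟩
      rintro D ⟨rfl | hD, hzD⟩
      · rfl
      · exact absurd (by simpa using hzpq) (hT.subset D hD hzD).2
    · obtain ⟨D, ⟨hD, hzD⟩, huniq⟩ := hT.existsUnique z ⟨hz, by simpa using hzpq⟩
      refine ⟨D, ⟨Set.mem_insert_of_mem _ hD, hzD⟩, ?_⟩
      rintro D' ⟨rfl | hD', hzD'⟩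
      · exact absurd hzD' hzpq
      · exact huniq D' ⟨hD', hzD'⟩

theorem IsDominoTiling.diff_pair {R : Set Cell} {p q : Cell} {T : Set (Finset Cell)}
    (hT : IsDominoTiling R T) (hmem : {p, q} ∈ T) :
    IsDominoTiling (R \ {p, q}) (T \ {{p, q}}) := by
  refine ⟨fun D hD => hT.isDomino D hD.1, ?_, ?_⟩
  · intro D hD z hz
    refine ⟨hT.subset D hD.1 hz, fun hzpq => hD.2 ?_⟩
    exact hT.eq_of_mem hD.1 hmem hz (by simpa using hzpq)
  · intro z hz
    obtain ⟨D, ⟨hD, hzD⟩, huniq⟩ := hT.existsUnique z hz.1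
    refine ⟨D, ⟨⟨hD, ?_⟩, hzD⟩, fun D' hD' => huniq D' ⟨hD'.1.1, hD'.2⟩⟩
    rintro rfl
    exact hz.2 (by simpa using hzD)

open scoped Classical in
/-- The number of domino tilings of a finite region, expanded by the domino covering a given
cell. -/
theorem numDominoTilings_eq_sum {R : Set Cell} (hR : R.Finite) {p : Cell} (hp : p ∈ R) :
    numDominoTilings R =
      ∑ q ∈ neighbors p, if q ∈ R then numDominoTilings (R \ {p, q}) else 0 := by
  have hdec : {T : Set (Finset Cell) | IsDominoTiling R T} =
      ⋃ q ∈ (((neighbors p).filter (· ∈ R) : Finset Cell) : Set Cell),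
        (insert {p, q}) '' {T | IsDominoTiling (R \ {p, q}) T} := by
    ext T
    simp only [Set.mem_ofPred_eq, Set.mem_iUnion, Finset.coe_filter, Set.mem_image, exists_prop]
    constructor
    · intro hT
      obtain ⟨D, ⟨hD, hpD⟩, -⟩ := hT.existsUnique p hp
      obtain ⟨q, hq, rfl⟩ := (hT.isDomino D hD).exists_neighbor hpD
      exact ⟨q, ⟨hq, hT.subset _ hD (by simp)⟩, _, hT.diff_pair hD,
        by rw [Set.insert_sdiff_singleton, Set.insert_eq_of_mem hD]⟩
    · rintro ⟨q, ⟨hq, hqR⟩, T', hT', rfl⟩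
      exact hT'.insert_pair hp hqR hq
  rw [numDominoTilings, hdec, Set.Finite.ncard_biUnion (Finset.finite_toSet _),
    finsum_mem_coe_finset, Finset.sum_filter]
  · refine Finset.sum_congr rfl fun q hq => ?_
    split_ifs with hqR
    · rw [Set.InjOn.ncard_image, numDominoTilings]
      intro T hT T' hT' h
      have hnot : ∀ U : Set (Finset Cell), IsDominoTiling (R \ {p, q}) U → {p, q} ∉ U :=
        fun U hU hmem => (hU.subset _ hmem (show p ∈ _ by simp)).2 (by simp)
      rw [← Set.insert_sdiff_self_of_notMem (hnot T hT),
        ← Set.insert_sdiff_self_of_notMem (hnot T' hT')]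
      exact congrArg (· \ {{p, q}}) h
    · rfl
  · intro q _
    exact (finite_setOf_isDominoTiling (hR.subset Set.sdiff_subset)).image _
  · intro q hq q' hq' hne
    rw [Function.onFun, Set.disjoint_left]
    rintro _ ⟨T, hT, rfl⟩ ⟨T', hT', h⟩
    simp only [Finset.coe_filter, Set.mem_ofPred_eq] at hq hq'
    have hT1 := hT.insert_pair hp hq.2 hq.1
    have hmem : ({p, q'} : Finset Cell) ∈ insert {p, q} T := by
      rw [← h]
      exact Set.mem_insert _ _
    have heq := hT1.eq_of_mem (Set.mem_insert _ _) hmem (p := p) (by simp) (by simp)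
    have hq'mem : q ∈ ({p, q'} : Finset Cell) := by rw [← heq]; simp
    simp only [Finset.mem_insert, Finset.mem_singleton] at hq'mem
    exact hq'mem.elim (ne_of_mem_neighbors hq.1) hne

/-! ### Rotated coordinates. -/

/-- The white cell with coordinates `x` in the rotated lattice. -/
def whiteCell (x : ℤ × ℤ) : Cell := (x.1 + x.2 - 1, x.1 - x.2)

/-- The black cell with coordinates `x` in the rotated lattice: the right neighbour of
`whiteCell x`. -/
def blackCell (x : ℤ × ℤ) : Cell := (x.1 + x.2, x.1 - x.2)

theorem whiteCell_inj {x y : ℤ × ℤ} : whiteCell x = whiteCell y ↔ x = y := by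
  simp only [whiteCell, Prod.ext_iff]
  omega

theorem blackCell_inj {x y : ℤ × ℤ} : blackCell x = blackCell y ↔ x = y := by
  simp only [blackCell, Prod.ext_iff]
  omega

theorem whiteCell_ne_blackCell (x y : ℤ × ℤ) : whiteCell x ≠ blackCell y := by
  simp only [whiteCell, blackCell, ne_eq, Prod.ext_iff]
  omega

theorem blackCell_ne_whiteCell (x y : ℤ × ℤ) : blackCell x ≠ whiteCell y :=
  (whiteCell_ne_blackCell y x).symm

theorem exists_eq_whiteCell_or_blackCell (z : Cell) :
    (∃ x, z = whiteCell x) ∨ ∃ x, z = blackCell x := by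
  rcases Int.even_or_odd' (z.1 + z.2) with ⟨k, hk | hk⟩
  · refine Or.inr ⟨(k, k - z.2), ?_⟩
    simp only [blackCell, Prod.ext_iff]
    omega
  · refine Or.inl ⟨(k + 1, k + 1 - z.2), ?_⟩
    simp only [whiteCell, Prod.ext_iff]
    omega

/-- The region consisting of the white and the black cells with coordinates in `S`, except for the
white cells with coordinates in `A` and the black cells with coordinates in `B`. -/
def latticeRegion (S A B : Finset (ℤ × ℤ)) : Set Cell :=
  {z | (∃ x ∈ S \ A, z = whiteCell x) ∨ ∃ x ∈ S \ B, z = blackCell x}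

theorem whiteCell_mem_latticeRegion {S A B : Finset (ℤ × ℤ)} {x : ℤ × ℤ} :
    whiteCell x ∈ latticeRegion S A B ↔ x ∈ S ∧ x ∉ A := by
  simp [latticeRegion, whiteCell_inj, whiteCell_ne_blackCell, -Prod.exists]

theorem blackCell_mem_latticeRegion {S A B : Finset (ℤ × ℤ)} {x : ℤ × ℤ} :
    blackCell x ∈ latticeRegion S A B ↔ x ∈ S ∧ x ∉ B := by
  simp [latticeRegion, blackCell_inj, blackCell_ne_whiteCell, -Prod.exists]

theorem finite_latticeRegion (S A B : Finset (ℤ × ℤ)) : (latticeRegion S A B).Finite := by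
  refine ((S.image whiteCell ∪ S.image blackCell).finite_toSet).subset ?_
  rintro z (⟨x, hx, rfl⟩ | ⟨x, hx, rfl⟩)
  · simp only [Finset.coe_union, Finset.coe_image]
    exact Or.inl ⟨x, (Finset.mem_sdiff.1 hx).1, rfl⟩
  · simp only [Finset.coe_union, Finset.coe_image]
    exact Or.inr ⟨x, (Finset.mem_sdiff.1 hx).1, rfl⟩

theorem eq_latticeRegion {R : Set Cell} {S A B : Finset (ℤ × ℤ)}
    (hw : ∀ x, whiteCell x ∈ R ↔ x ∈ S ∧ x ∉ A) (hb : ∀ x, blackCell x ∈ R ↔ x ∈ S ∧ x ∉ B) :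
    R = latticeRegion S A B := by
  ext z
  rcases exists_eq_whiteCell_or_blackCell z with ⟨x, rfl⟩ | ⟨x, rfl⟩
  · rw [hw, whiteCell_mem_latticeRegion]
  · rw [hb, blackCell_mem_latticeRegion]

theorem sum_neighbors (f : Cell → ℕ) (p : Cell) :
    ∑ q ∈ neighbors p, f q =
      f (p.1 + 1, p.2) + f (p.1 - 1, p.2) + f (p.1, p.2 + 1) + f (p.1, p.2 - 1) := by
  unfold neighbors
  rw [Finset.sum_insert, Finset.sum_insert, Finset.sum_insert, Finset.sum_singleton, add_assoc,
    add_assoc]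
  all_goals
    simp only [Finset.mem_insert, Finset.mem_singleton, Prod.ext_iff]
    omega

theorem sum_neighbors_whiteCell (f : Cell → ℕ) (x : ℤ × ℤ) :
    ∑ q ∈ neighbors (whiteCell x), f q = f (blackCell x) + f (blackCell (x.1 - 1, x.2 - 1)) +
      f (blackCell (x.1, x.2 - 1)) + f (blackCell (x.1 - 1, x.2)) := by
  rw [sum_neighbors]
  simp only [whiteCell, blackCell]
  ring_nf

theorem sum_neighbors_blackCell (f : Cell → ℕ) (x : ℤ × ℤ) :
    ∑ q ∈ neighbors (blackCell x), f q = f (whiteCell (x.1 + 1, x.2 + 1)) + f (whiteCell x) +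
      f (whiteCell (x.1 + 1, x.2)) + f (whiteCell (x.1, x.2 + 1)) := by
  rw [sum_neighbors]
  simp only [whiteCell, blackCell]
  ring_nf

/-! ### Peeling off a lowest point. -/

/-- `t` is an element of `S` with minimal sum of coordinates. -/
def IsLowest (S : Finset (ℤ × ℤ)) (t : ℤ × ℤ) : Prop :=
  t ∈ S ∧ ∀ x ∈ S, t.1 + t.2 ≤ x.1 + x.2

theorem exists_isLowest {S : Finset (ℤ × ℤ)} (hS : S.Nonempty) : ∃ t, IsLowest S t := by
  obtain ⟨t, ht, h⟩ := S.exists_min_image (fun x => x.1 + x.2) hS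
  exact ⟨t, ht, h⟩

theorem IsLowest.notMem {S : Finset (ℤ × ℤ)} {t : ℤ × ℤ} (h : IsLowest S t) {x : ℤ × ℤ}
    (hx : x.1 + x.2 < t.1 + t.2) : x ∉ S := fun hxS => by
  have := h.2 x hxS
  omega

variable {S A B : Finset (ℤ × ℤ)} {t : ℤ × ℤ}

/-- Apart from black `t`, the black neighbours of white `t` have smaller coordinate sum, hence lie
outside `S`: the domino at white `t` is forced. -/
theorem IsLowest.numDominoTilings_of_notMem (h : IsLowest S t) (hA : t ∉ A) (hB : t ∉ B) :
    numDominoTilings (latticeRegion S A B) =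
      numDominoTilings (latticeRegion (S.erase t) A B) := by
  classical
  rw [numDominoTilings_eq_sum (finite_latticeRegion S A B)
    (whiteCell_mem_latticeRegion.2 ⟨h.1, hA⟩), sum_neighbors_whiteCell,
    if_pos (blackCell_mem_latticeRegion.2 ⟨h.1, hB⟩), if_neg, if_neg, if_neg]
  · simp only [add_zero]
    congr 1
    refine eq_latticeRegion (fun x => ?_) (fun x => ?_)
    · rw [Set.mem_sdiff, whiteCell_mem_latticeRegion]
      simp only [Set.mem_insert_iff, Set.mem_singleton_iff, whiteCell_inj, whiteCell_ne_blackCell,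
        Finset.mem_erase]
      tauto
    · rw [Set.mem_sdiff, blackCell_mem_latticeRegion]
      simp only [Set.mem_insert_iff, Set.mem_singleton_iff, blackCell_inj, blackCell_ne_whiteCell,
        Finset.mem_erase]
      tauto
  all_goals
    rw [blackCell_mem_latticeRegion]
    exact fun hx => h.notMem (by simp only; omega) hx.1

theorem IsLowest.numDominoTilings_eq_zero (h : IsLowest S t) (hA : t ∉ A) (hB : t ∈ B) :
    numDominoTilings (latticeRegion S A B) = 0 := by
  classical
  rw [numDominoTilings_eq_sum (finite_latticeRegion S A B)
    (whiteCell_mem_latticeRegion.2 ⟨h.1, hA⟩), sum_neighbors_whiteCell, if_neg, if_neg, if_neg,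
    if_neg]
  on_goal 4 =>
    rw [blackCell_mem_latticeRegion]
    exact fun hx => hx.2 hB
  all_goals
    rw [blackCell_mem_latticeRegion]
    exact fun hx => h.notMem (by simp only; omega) hx.1

/-- With white `t` missing, black `t` must be paired with white `w` one Delannoy step further on.
After discarding `t`, the white hole has moved to `w`: the path takes one step. -/
theorem IsLowest.numDominoTilings_of_mem (h : IsLowest S t) (hA : t ∈ A) (hB : t ∉ B)
    {F : ℤ × ℤ → ℕ} (hF : ∀ w, F w = if w ∈ S ∧ w ∉ A then
      numDominoTilings (latticeRegion (S.erase t) (insert w (A.erase t)) B) else 0) :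
    numDominoTilings (latticeRegion S A B) =
      F (t.1 + 1, t.2) + F (t.1, t.2 + 1) + F (t.1 + 1, t.2 + 1) := by
  classical
  have key : ∀ w : ℤ × ℤ,
      (if whiteCell w ∈ latticeRegion S A B then
        numDominoTilings (latticeRegion S A B \ {blackCell t, whiteCell w}) else 0) = F w := by
    intro w
    rw [hF, whiteCell_mem_latticeRegion]
    by_cases hw : w ∈ S ∧ w ∉ A
    · have hwt : w ≠ t := by
        rintro rfl
        exact hw.2 hA
      rw [if_pos hw, if_pos hw]
      congr 1
      refine eq_latticeRegion (fun x => ?_) (fun x => ?_)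
      · rw [Set.mem_sdiff, whiteCell_mem_latticeRegion]
        simp only [Set.mem_insert_iff, Set.mem_singleton_iff, whiteCell_inj,
          whiteCell_ne_blackCell, Finset.mem_erase, Finset.mem_insert]
        by_cases hx : x = t
        · subst hx; tauto
        · tauto
      · rw [Set.mem_sdiff, blackCell_mem_latticeRegion]
        simp only [Set.mem_insert_iff, Set.mem_singleton_iff, blackCell_inj,
          blackCell_ne_whiteCell, Finset.mem_erase]
        tauto
    · rw [if_neg hw, if_neg hw]
  have ht : F t = 0 := by
    rw [hF, if_neg fun hw => hw.2 hA]
  rw [numDominoTilings_eq_sum (finite_latticeRegion S A B)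
    (blackCell_mem_latticeRegion.2 ⟨h.1, hB⟩), sum_neighbors_blackCell, key, key, key, key, ht]
  ring

theorem IsLowest.latticeRegion_of_mem_of_mem (hA : t ∈ A) (hB : t ∈ B) :
    latticeRegion S A B = latticeRegion (S.erase t) (A.erase t) (B.erase t) := by
  refine eq_latticeRegion (fun x => ?_) (fun x => ?_)
  · rw [whiteCell_mem_latticeRegion, Finset.mem_erase, Finset.mem_erase]
    by_cases hx : x = t
    · subst hx; tauto
    · tauto
  · rw [blackCell_mem_latticeRegion, Finset.mem_erase, Finset.mem_erase]
    by_cases hx : x = t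
    · subst hx; tauto
    · tauto

/-! ### Tilings as Delannoy paths: at most one path. -/

/-- `w` is reached from `u` by one step of a Delannoy path. -/
def IsStep (u w : ℤ × ℤ) : Prop :=
  w = (u.1 + 1, u.2) ∨ w = (u.1, u.2 + 1) ∨ w = (u.1 + 1, u.2 + 1)

/-- `S` contains every point below `e` that lies above a point of `S`, in the product order. -/
def IsClosedUpTo (e : ℤ × ℤ) (S : Finset (ℤ × ℤ)) : Prop :=
  ∀ x ∈ S, ∀ y : ℤ × ℤ, x.1 ≤ y.1 → x.2 ≤ y.2 → y.1 ≤ e.1 → y.2 ≤ e.2 → y ∈ S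

theorem IsClosedUpTo.erase {e : ℤ × ℤ} (hS : IsClosedUpTo e S) (ht : IsLowest S t) :
    IsClosedUpTo e (S.erase t) := by
  intro x hx y h1 h2 h3 h4
  rw [Finset.mem_erase] at hx ⊢
  refine ⟨?_, hS x hx.2 y h1 h2 h3 h4⟩
  rintro rfl
  have := ht.2 x hx.2
  exact hx.1 (Prod.ext (by omega) (by omega))

theorem IsClosedUpTo.not_le_of_notMem {e u w : ℤ × ℤ} (hS : IsClosedUpTo e S) (hu : u ∈ S)
    (hw : IsStep u w) (hwS : w ∉ S) : ¬ (w.1 ≤ e.1 ∧ w.2 ≤ e.2) := by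
  rintro ⟨h1, h2⟩
  refine hwS (hS u hu w ?_ ?_ h1 h2) <;>
  · rcases hw with rfl | rfl | rfl <;> simp

theorem IsLowest.numDominoTilings_step (h : IsLowest S t) (hA : t ∈ A) (hB : t ∉ B)
    {G : ℤ × ℤ → ℤ}
    (hG : ∀ w, IsStep t w → w ∈ S → w ∉ A →
      (numDominoTilings (latticeRegion (S.erase t) (insert w (A.erase t)) B) : ℤ) = G w)
    (hG0 : ∀ w, IsStep t w → (w ∉ S ∨ w ∈ A) → G w = 0) :
    (numDominoTilings (latticeRegion S A B) : ℤ) =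
      G (t.1 + 1, t.2) + G (t.1, t.2 + 1) + G (t.1 + 1, t.2 + 1) := by
  have key : ∀ w, IsStep t w → (((if w ∈ S ∧ w ∉ A then
      numDominoTilings (latticeRegion (S.erase t) (insert w (A.erase t)) B) else 0 : ℕ)) : ℤ) =
      G w := by
    intro w hw
    split_ifs with hwS
    · exact hG w hw hwS.1 hwS.2
    · rw [hG0 w hw (by tauto), Nat.cast_zero]
  rw [h.numDominoTilings_of_mem hA hB fun w => rfl, Nat.cast_add, Nat.cast_add,
    key _ (Or.inl rfl), key _ (Or.inr (Or.inl rfl)), key _ (Or.inr (Or.inr rfl))]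

theorem numDominoTilings_latticeRegion_empty (S : Finset (ℤ × ℤ)) :
    numDominoTilings (latticeRegion S ∅ ∅) = 1 := by
  induction S using Finset.strongInduction with
  | H S ih =>
    rcases S.eq_empty_or_nonempty with rfl | hS
    · rw [show latticeRegion ∅ ∅ ∅ = ∅ by simp [latticeRegion], numDominoTilings_empty]
    · obtain ⟨t, ht⟩ := exists_isLowest hS
      rw [ht.numDominoTilings_of_notMem (by simp) (by simp)]
      exact ih _ (Finset.erase_ssubset ht.1)

theorem numDominoTilings_latticeRegion_singleton {e u : ℤ × ℤ} (S : Finset (ℤ × ℤ))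
    (hS : IsClosedUpTo e S) (he : e ∈ S) (hu : u ∈ S) :
    (numDominoTilings (latticeRegion S {u} {e}) : ℤ) = delannoyInt (e.1 - u.1) (e.2 - u.2) := by
  induction S using Finset.strongInduction generalizing u with
  | H S ih =>
    obtain ⟨t, ht⟩ := exists_isLowest ⟨u, hu⟩
    by_cases htu : t = u
    · subst htu
      by_cases hte : t = e
      · subst hte
        rw [IsLowest.latticeRegion_of_mem_of_mem (t := t) (by simp) (by simp), Finset.erase_singleton,
          numDominoTilings_latticeRegion_empty, sub_self, sub_self,
          delannoyInt_zero_zero, Nat.cast_one]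
      · rw [ht.numDominoTilings_step (G := fun w => delannoyInt (e.1 - w.1) (e.2 - w.2))
          (by simp) (by simpa using hte), delannoyInt_rec (p := e.1 - t.1) (q := e.2 - t.2)]
        · simp only
          ring_nf
        · rintro ⟨h1, h2⟩
          exact hte (Prod.ext (by omega) (by omega))
        · intro w hw hwS hwt
          rw [Finset.mem_singleton] at hwt
          rw [Finset.erase_singleton]
          exact ih _ (Finset.erase_ssubset ht.1) (hS.erase ht)
            (Finset.mem_erase.2 ⟨Ne.symm hte, he⟩) (Finset.mem_erase.2 ⟨hwt, hwS⟩)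
        -- A step that leaves `S` leaves the quadrant below `e`, where the count is zero.
        · intro w hw hwS
          refine delannoyInt_eq_zero ?_
          have hwS' : w ∉ S := by
            rcases hwS with hwS | hwS
            · exact hwS
            · rw [Finset.mem_singleton] at hwS
              simp only [IsStep, Prod.ext_iff, hwS] at hw
              omega
          have := hS.not_le_of_notMem hu hw hwS'
          omega
    · by_cases hte : t = e
      · subst hte
        rw [ht.numDominoTilings_eq_zero (by simpa using htu) (by simp), delannoyInt_eq_zero,
          Nat.cast_zero]
        have := ht.2 u hu
        rintro ⟨h1, h2⟩
        exact htu (Prod.ext (by omega) (by omega))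
      · rw [ht.numDominoTilings_of_notMem (by simpa using htu) (by simpa using hte)]
        exact ih _ (Finset.erase_ssubset ht.1) (hS.erase ht)
          (Finset.mem_erase.2 ⟨Ne.symm hte, he⟩) (Finset.mem_erase.2 ⟨Ne.symm htu, hu⟩)

/-! ### Two disjoint paths. -/

/-- The number of pairs of disjoint Delannoy paths from `u` and `v` to `e - (c, c)` and `e`, where
`u` lies northwest of `v`. -/
def pathPairs (c : ℕ) (e u v : ℤ × ℤ) : ℤ :=
  signedHits c (e.1 - u.1) (e.2 - u.2) * delannoyInt (e.1 - c - v.1) (e.2 - c - v.2) -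
    delannoyInt (e.1 - c - u.1) (e.2 - c - u.2) * signedHits c (e.1 - v.1) (e.2 - v.2)

theorem pathPairs_swap (c : ℕ) (e u v : ℤ × ℤ) : pathPairs c e u v = -pathPairs c e v u := by
  unfold pathPairs
  ring

theorem pathPairs_self (c : ℕ) (e u : ℤ × ℤ) : pathPairs c e u u = 0 := by
  unfold pathPairs
  ring

theorem pathPairs_eq_zero_of_not_le (c : ℕ) {e u : ℤ × ℤ} (v : ℤ × ℤ)
    (h : ¬ (u.1 ≤ e.1 ∧ u.2 ≤ e.2)) : pathPairs c e u v = 0 := by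
  rw [pathPairs, signedHits_eq_zero _ (by omega), delannoyInt_eq_zero (p := e.1 - c - u.1)
    (by omega)]
  ring

theorem pathPairs_rec {c : ℕ} {e u : ℤ × ℤ} (v : ℤ × ℤ) (hu : u ≠ (e.1 - c, e.2 - c))
    (h : u.1 + u.2 ≤ e.1 - c + (e.2 - c)) :
    pathPairs c e u v = pathPairs c e (u.1 + 1, u.2) v + pathPairs c e (u.1, u.2 + 1) v +
      pathPairs c e (u.1 + 1, u.2 + 1) v := by
  unfold pathPairs
  rw [signedHits_rec c (by omega), delannoyInt_rec (p := e.1 - c - u.1)]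
  · simp only
    ring_nf
  · rintro ⟨h1, h2⟩
    exact hu (Prod.ext (by simp only; omega) (by simp only; omega))

/-- The lower path moves. A collision `w = v` contributes nothing because `pathPairs` vanishes on
equal arguments. The sign `ε` lets the same step serve for the southeast path, which enters
`pathPairs` as second argument. -/
theorem IsLowest.numDominoTilings_pair_step {c : ℕ} {e u v : ℤ × ℤ} (hu : IsLowest S u)
    (hS : IsClosedUpTo e S) (hv : v ∈ S) (huv : u ≠ v)
    (hs : (e.1 - (c : ℤ), e.2 - (c : ℤ)) ∈ S) (hne : u ≠ (e.1 - c, e.2 - c)) (hue : u ≠ e)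
    {ε : ℤ}
    (ih : ∀ w, IsStep u w → w ∈ S → w ≠ v →
      (numDominoTilings (latticeRegion (S.erase u) {w, v} {(e.1 - c, e.2 - c), e}) : ℤ) =
        ε * pathPairs c e w v) :
    (numDominoTilings (latticeRegion S {u, v} {(e.1 - c, e.2 - c), e}) : ℤ) =
      ε * pathPairs c e u v := by
  have hl := hu.2 _ hs
  rw [hu.numDominoTilings_step (G := fun w => ε * pathPairs c e w v) (by simp)
    (by simp [hne, hue]), pathPairs_rec v hne hl]
  · ring
  · intro w hw hwS hwA
    simp only [Finset.mem_insert, Finset.mem_singleton, not_or] at hwA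
    rw [Finset.erase_insert (by simpa using huv)]
    exact ih w hw hwS hwA.2
  · intro w hw hwS
    simp only [Finset.mem_insert, Finset.mem_singleton] at hwS
    rcases hwS with hwS | rfl | rfl
    · rw [pathPairs_eq_zero_of_not_le c v (hS.not_le_of_notMem hu.1 hw hwS), mul_zero]
    · simp only [IsStep, Prod.ext_iff] at hw
      omega
    · rw [pathPairs_self, mul_zero]

/-- When one path has ended at `e - (c, c)`, the other lies past that point in one coordinate, so it
can meet the diagonal only late and its restricted count becomes the full Delannoy number. -/
theorem pathPairs_northwest_end {c : ℕ} {e u : ℤ × ℤ} (h1 : u.1 ≤ e.1 - c) (h2 : e.2 - c < u.2) :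
    pathPairs c e u (e.1 - c, e.2 - c) = delannoyInt (e.1 - u.1) (e.2 - u.2) := by
  rw [pathPairs]
  simp only [sub_self, sub_sub_cancel, signedHits_self, mul_zero, sub_zero]
  rw [signedHits_of_lt _ (by omega), lateHitsInt_of_lt (by omega) (by omega)]
  rw [delannoyInt_zero_zero, mul_one]

theorem pathPairs_southeast_end {c : ℕ} {e v : ℤ × ℤ} (h1 : e.1 - c < v.1) (h2 : v.2 ≤ e.2 - c) :
    pathPairs c e (e.1 - c, e.2 - c) v = delannoyInt (e.1 - v.1) (e.2 - v.2) := by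
  rw [pathPairs]
  simp only [sub_self, sub_sub_cancel, signedHits_self, zero_mul, zero_sub]
  rw [signedHits_of_gt _ (by omega), lateHitsInt_comm, lateHitsInt_of_lt (by omega) (by omega)]
  rw [delannoyInt_zero_zero, one_mul, neg_neg, delannoyInt_comm]

/-- Both sides are followed while the lowest point is peeled off, until it is `e - (c, c)`. Up to
that level `pathPairs` obeys the path recursion in each argument; there it takes the right end
values. -/
theorem numDominoTilings_latticeRegion_pair {c : ℕ} (hc : 1 ≤ c) {e u v : ℤ × ℤ}
    (S : Finset (ℤ × ℤ)) (hS : IsClosedUpTo e S) (he : e ∈ S)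
    (hs : (e.1 - (c : ℤ), e.2 - (c : ℤ)) ∈ S) (hu : u ∈ S) (hv : v ∈ S) (huv : u ≠ v)
    (h1 : u.1 ≤ v.1) (h2 : v.2 ≤ u.2) :
    (numDominoTilings (latticeRegion S {u, v} {(e.1 - c, e.2 - c), e}) : ℤ) =
      pathPairs c e u v := by
  have hse : (e.1 - (c : ℤ), e.2 - (c : ℤ)) ≠ e := by
    rw [ne_eq, Prod.ext_iff]
    simp only
    omega
  induction S using Finset.strongInduction generalizing u v with
  | H S ih =>
    obtain ⟨t, ht⟩ := exists_isLowest ⟨u, hu⟩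
    have hl := ht.2 _ hs
    have hlu := ht.2 _ hu
    have hlv := ht.2 _ hv
    simp only at hl
    have hte : t ≠ e := by rintro rfl; omega
    have he' : e ∈ S.erase t := Finset.mem_erase.2 ⟨hte.symm, he⟩
    have hlt := Finset.erase_ssubset ht.1
    have hS' := hS.erase ht
    by_cases hts : t = (e.1 - c, e.2 - c)
    · have hlow : ∀ {x : ℤ × ℤ}, x ≠ t → t.1 + t.2 ≤ x.1 + x.2 →
          ¬ (x.1 ≤ e.1 - c ∧ x.2 ≤ e.2 - c) := by
        intro x hx hx'
        rw [hts] at hx hx'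
        simp only at hx'
        rintro ⟨h, h'⟩
        exact hx (Prod.ext (by simp only; omega) (by simp only; omega))
      by_cases htu : t = u
      · have hv' := hlow (fun h => huv (htu ▸ h.symm)) hlv
        rw [IsLowest.latticeRegion_of_mem_of_mem (t := t) (by simp [htu]) (by simp [hts])]
        rw [htu, Finset.erase_insert (by simpa using huv), ← htu, hts,
          Finset.erase_insert (by simpa using hse), ← hts,
          numDominoTilings_latticeRegion_singleton _ hS' he'
            (Finset.mem_erase.2 ⟨fun h => huv (htu ▸ h.symm), hv⟩), hts,
          pathPairs_southeast_end]
        all_goals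
          rw [← htu, hts] at h1 h2
          simp only at h1 h2
          omega
      · by_cases htv : t = v
        · have hu' := hlow (fun h => htu h.symm) hlu
          rw [IsLowest.latticeRegion_of_mem_of_mem (t := t) (by simp [htv]) (by simp [hts])]
          rw [Finset.pair_comm u, htv, Finset.erase_insert (by simpa using huv.symm), ← htv, hts,
            Finset.erase_insert (by simpa using hse), ← hts,
            numDominoTilings_latticeRegion_singleton _ hS' he'
              (Finset.mem_erase.2 ⟨fun h => htu h.symm, hu⟩), hts,
            pathPairs_northwest_end]
          all_goals
            rw [← htv, hts] at h1 h2
            simp only at h1 h2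
            omega
        -- Neither path can reach `e - (c, c)` any more, and both Delannoy factors in `pathPairs`
        -- vanish.
        · rw [ht.numDominoTilings_eq_zero (by simp [htu, htv]) (by simp [hts]), pathPairs,
            delannoyInt_eq_zero, delannoyInt_eq_zero]
          · simp
          · have := hlow (fun h => htu h.symm) hlu
            omega
          · have := hlow (fun h => htv h.symm) hlv
            omega
    · have hs' := Finset.mem_erase.2 ⟨Ne.symm hts, hs⟩
      by_cases htu : t = u
      · subst htu
        rw [ht.numDominoTilings_pair_step hS hv huv hs hts hte (ε := 1), one_mul]
        intro w hw hwS hwv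
        rw [one_mul]
        -- Since `t` is lowest and differs from `v`, it is strictly west of `v`, so its step cannot
        -- break the northwest order.
        have hne : ¬ (t.1 = v.1 ∧ t.2 = v.2) := fun h => huv (Prod.ext h.1 h.2)
        simp only [IsStep, Prod.ext_iff] at hw
        refine ih _ hlt hS' he' hs' (Finset.mem_erase.2 ⟨?_, hwS⟩)
          (Finset.mem_erase.2 ⟨huv.symm, hv⟩) hwv ?_ ?_
        · rw [ne_eq, Prod.ext_iff]; omega
        · omega
        · omega
      · by_cases htv : t = v
        · subst htv
          rw [Finset.pair_comm, ht.numDominoTilings_pair_step hS hu huv.symm hs hts hte (ε := -1),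
            pathPairs_swap c e u]
          · ring
          intro w hw hwS hwu
          rw [Finset.pair_comm, neg_one_mul, ← pathPairs_swap]
          have hne : ¬ (u.1 = t.1 ∧ u.2 = t.2) := fun h => huv (Prod.ext h.1 h.2)
          simp only [IsStep, Prod.ext_iff] at hw
          refine ih _ hlt hS' he' hs' (Finset.mem_erase.2 ⟨huv, hu⟩)
            (Finset.mem_erase.2 ⟨?_, hwS⟩) hwu.symm ?_ ?_
          · rw [ne_eq, Prod.ext_iff]; omega
          · omega
          · omega
        · rw [ht.numDominoTilings_of_notMem (by simp [htu, htv]) (by simp [hts, hte])]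
          exact ih _ hlt hS' he' hs' (Finset.mem_erase.2 ⟨Ne.symm htu, hu⟩)
            (Finset.mem_erase.2 ⟨Ne.symm htv, hv⟩) huv h1 h2

/-! ### The second start lies on the diagonal of the ends. -/

theorem numDominoTilings_latticeRegion_diagonal {a b c : ℕ} (hc : 1 ≤ c) {e u v : ℤ × ℤ}
    (hv1 : v.1 = e.1 - c - b) (hv2 : v.2 = e.2 - c - b)
    (S : Finset (ℤ × ℤ)) (hS : IsClosedUpTo e S) (he : e ∈ S)
    (hs : (e.1 - (c : ℤ), e.2 - (c : ℤ)) ∈ S) (hu : u ∈ S) (hv : v ∈ S) (huv : u ≠ v)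
    (h1 : u.1 ≤ v.1) (h2 : u.2 ≤ v.2) (hua : v.1 - a ≤ u.1) :
    (numDominoTilings (latticeRegion S {u, v} {(e.1 - c, e.2 - c), e}) : ℤ) =
      delannoy b b * avoidingPaths a b c (e.1 - u.1) (e.2 - u.2) := by
  have hg : delannoyInt (e.1 - c - v.1) (e.2 - c - v.2) = delannoy b b := by
    rw [← delannoyInt_natCast]
    congr 1 <;> omega
  have hsv : signedHits c (e.1 - v.1) (e.2 - v.2) = 0 := by
    rw [show e.1 - v.1 = e.2 - v.2 by omega, signedHits_self]
  have hne : ∀ {w : ℤ × ℤ}, w ≠ v → ¬ (w.1 = v.1 ∧ w.2 = v.2) := fun h h' =>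
    h (Prod.ext h'.1 h'.2)
  induction S using Finset.strongInduction generalizing u with
  | H S ih =>
    have hne' := hne huv
    -- On the edges of the quadrant below `v` the pair formula applies. It loses its second term, as
    -- `v` is on the diagonal, and the sum in `avoidingPaths` is empty there.
    by_cases hu2 : u.2 = v.2
    · rw [numDominoTilings_latticeRegion_pair hc S hS he hs hu hv huv h1 hu2.ge, pathPairs, hg,
        hsv, signedHits_of_lt c (by omega), avoidingPaths_of_not_lt a b c (by omega)]
      ring
    by_cases hu1 : u.1 = v.1
    · rw [Finset.pair_comm, numDominoTilings_latticeRegion_pair hc S hS he hs hv hu huv.symm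
        hu1.ge h2, pathPairs, hg, hsv, signedHits_of_gt c (by omega),
        avoidingPaths_of_not_lt a b c (by omega)]
      ring
    obtain ⟨t, ht⟩ := exists_isLowest ⟨u, hu⟩
    have hlu := ht.2 _ hu
    have hlt := Finset.erase_ssubset ht.1
    have hS' := hS.erase ht
    have htv : t ≠ v := by rintro rfl; omega
    have hts : t ≠ (e.1 - c, e.2 - c) := by rintro rfl; simp only at hlu; omega
    have hte : t ≠ e := by rintro rfl; omega
    have he' : e ∈ S.erase t := Finset.mem_erase.2 ⟨hte.symm, he⟩
    have hs' := Finset.mem_erase.2 ⟨hts.symm, hs⟩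
    have hv' := Finset.mem_erase.2 ⟨htv.symm, hv⟩
    by_cases htu : t = u
    · subst htu
      rw [ht.numDominoTilings_step (G := fun w => delannoy b b *
        avoidingPaths a b c (e.1 - w.1) (e.2 - w.2)) (by simp) (by simp [hts, hte]),
        avoidingPaths_rec a b c (p := e.1 - t.1) (q := e.2 - t.2) (by omega) (by omega)]
      · simp only
        ring_nf
      · intro w hw hwS hwA
        simp only [Finset.mem_insert, Finset.mem_singleton, not_or] at hwA
        rw [Finset.erase_insert (by simpa using huv)]
        simp only [IsStep, Prod.ext_iff] at hw
        exact ih _ hlt hS' he' hs' (Finset.mem_erase.2 ⟨hwA.1, hwS⟩) hv' hwA.2 (by omega)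
          (by omega) (by omega)
      · intro w hw hwS
        simp only [Finset.mem_insert, Finset.mem_singleton] at hwS
        rcases hwS with hwS | rfl | rfl
        · have h := hS.not_le_of_notMem hu hw hwS
          simp only [IsStep, Prod.ext_iff] at hw
          omega
        · simp only [IsStep, Prod.ext_iff] at hw
          omega
        -- A step onto `v` is forbidden; accordingly `avoidingPaths` is zero at this diagonal point,
        -- whose distance `b + c` is at least `c`.
        · rw [avoidingPaths_of_not_lt a b c (by omega), show e.2 - w.2 = e.1 - w.1 by omega,
            lateHitsInt_self _ _ (by omega), mul_zero]
    · rw [ht.numDominoTilings_of_notMem (by simp [htu, htv]) (by simp [hts, hte])]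
      exact ih _ hlt hS' he' hs' (Finset.mem_erase.2 ⟨Ne.symm htu, hu⟩) hv' huv h1 h2 hua

/-! ### The mixed Aztec rectangle in rotated coordinates. -/

theorem mem_mixedAztecRectangle {m n : ℕ} {z : Cell} :
    z ∈ mixedAztecRectangle m n ↔
      0 < z.1 + z.2 ∧ z.1 + z.2 ≤ 2 * n ∧ 0 < z.1 - z.2 ∧ z.1 - z.2 < 2 * m + 1 := by
  simp only [mixedAztecRectangle, southwestSquares, southeastSquares, aztecRectangle,
    Set.mem_sdiff, Set.mem_union, Set.mem_ofPred_eq]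
  omega

theorem whiteCell_mem_mixedAztecRectangle {m n : ℕ} {x : ℤ × ℤ} :
    whiteCell x ∈ mixedAztecRectangle m n ↔ x ∈ Finset.Icc 1 (n : ℤ) ×ˢ Finset.Icc 1 (m : ℤ) := by
  rw [mem_mixedAztecRectangle, Finset.mem_product, Finset.mem_Icc, Finset.mem_Icc]
  simp only [whiteCell]
  omega

theorem blackCell_mem_mixedAztecRectangle {m n : ℕ} {x : ℤ × ℤ} :
    blackCell x ∈ mixedAztecRectangle m n ↔ x ∈ Finset.Icc 1 (n : ℤ) ×ˢ Finset.Icc 1 (m : ℤ) := by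
  rw [mem_mixedAztecRectangle, Finset.mem_product, Finset.mem_Icc, Finset.mem_Icc]
  simp only [blackCell]
  omega

theorem IsWhite.exists_eq_whiteCell {p : Cell} (h : IsWhite p) : ∃ u, p = whiteCell u := by
  refine (exists_eq_whiteCell_or_blackCell p).resolve_right ?_
  rintro ⟨x, rfl⟩
  exact h ⟨x.1, by simp only [blackCell]; ring⟩

/-- A horizontal row of cells becomes a diagonal of the grid, so all four holes lie on one diagonal.
-/
theorem fourHoles_whiteCell (a b c : ℕ) (u : ℤ × ℤ) :
    fourHoles a b c (whiteCell u) =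
      {whiteCell u, whiteCell (u.1 + a, u.2 + a), blackCell (u.1 + a + b, u.2 + a + b),
        blackCell (u.1 + a + b + c, u.2 + a + b + c)} := by
  unfold fourHoles
  simp only [whiteCell, blackCell]
  congr 3 <;> ring_nf

theorem numDominoTilings_holeyMixedAztecRectangle {a b c m n : ℕ} (ha : 1 ≤ a) (hc : 1 ≤ c)
    {p : Cell} (hp : IsAdmissible m n a b c p) :
    numDominoTilings (holeyMixedAztecRectangle m n a b c p) =
      2 * delannoy b b *
        ∑ i ∈ Finset.Icc 1 a, ∑ j ∈ Finset.Icc 1 c,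
          Nat.largeSchroder (b + i + j - 1) * delannoy (a - i) (a - i) *
            delannoy (c - j) (c - j) := by
  obtain ⟨u, rfl⟩ := hp.white₁.exists_eq_whiteCell
  have hin := hp.inside
  rw [fourHoles_whiteCell] at hin
  simp only [Set.insert_subset_iff, Set.singleton_subset_iff, whiteCell_mem_mixedAztecRectangle,
    blackCell_mem_mixedAztecRectangle] at hin
  obtain ⟨hu, hv, hs, he⟩ := hin
  set e : ℤ × ℤ := (u.1 + a + b + c, u.2 + a + b + c) with he_def
  have hse : ((u.1 + a + b, u.2 + a + b) : ℤ × ℤ) = (e.1 - c, e.2 - c) := by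
    rw [he_def]
    ext <;> simp
  rw [hse] at hs
  have hR : holeyMixedAztecRectangle m n a b c (whiteCell u) =
      latticeRegion (Finset.Icc 1 (n : ℤ) ×ˢ Finset.Icc 1 (m : ℤ)) {u, (u.1 + a, u.2 + a)}
        {(e.1 - c, e.2 - c), e} := by
    refine eq_latticeRegion (fun x => ?_) (fun x => ?_)
    · rw [holeyMixedAztecRectangle, fourHoles_whiteCell, Set.mem_sdiff,
        whiteCell_mem_mixedAztecRectangle]
      simp [whiteCell_inj, whiteCell_ne_blackCell, -Finset.mem_product]
    · rw [holeyMixedAztecRectangle, fourHoles_whiteCell, Set.mem_sdiff,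
        blackCell_mem_mixedAztecRectangle, ← he_def, hse]
      simp [blackCell_inj, blackCell_ne_whiteCell, -Finset.mem_product]
  -- The grid enters only through this closure property and the four membership facts, which is why
  -- `m`, `n` and the position disappear from the count.
  have hclosed : IsClosedUpTo e (Finset.Icc 1 (n : ℤ) ×ˢ Finset.Icc 1 (m : ℤ)) := by
    intro x hx y h1 h2 h3 h4
    simp only [Finset.mem_product, Finset.mem_Icc] at hx he ⊢
    omega
  have key := numDominoTilings_latticeRegion_diagonal (a := a) (b := b) hc (e := e) (u := u)
    (v := (u.1 + a, u.2 + a)) (by simp only [he_def]; ring) (by simp only [he_def]; ring) _ hclosed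
    he hs hu hv (by rw [ne_eq, Prod.ext_iff]; simp only; omega) (by simp) (by simp) (by simp)
  rw [show e.1 - u.1 = ((a + b + c : ℕ) : ℤ) by simp only [he_def]; push_cast; ring,
    show e.2 - u.2 = ((a + b + c : ℕ) : ℤ) by simp only [he_def]; push_cast; ring,
    avoidingPaths_natCast, ← hR] at key
  have key' := key.trans (b := _) (c := ((2 * delannoy b b *
        ∑ i ∈ Finset.Icc 1 a, ∑ j ∈ Finset.Icc 1 c,
          Nat.largeSchroder (b + i + j - 1) * delannoy (a - i) (a - i) *
            delannoy (c - j) (c - j) : ℕ) : ℤ)) (by push_cast; ring)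
  exact_mod_cast key'

theorem mainTheorem3 (a b c : ℕ) (ha : 1 ≤ a) (hc : 1 ≤ c) :
    (∀ (m n : ℕ) (p : Cell), IsAdmissible m n a b c p →
      numDominoTilings (holeyMixedAztecRectangle m n a b c p) =
        2 * delannoy b b *
          ∑ i ∈ Finset.Icc 1 a, ∑ j ∈ Finset.Icc 1 c,
            Nat.largeSchroder (b + i + j - 1) * delannoy (a - i) (a - i) *
              delannoy (c - j) (c - j)) ∧
    (∀ (m n m' n' : ℕ) (p p' : Cell),
      IsAdmissible m n a b c p → IsAdmissible m' n' a b c p' →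
        numDominoTilings (holeyMixedAztecRectangle m n a b c p) =
          numDominoTilings (holeyMixedAztecRectangle m' n' a b c p')) := by
  refine ⟨fun m n p hp => numDominoTilings_holeyMixedAztecRectangle ha hc hp,
    fun m n m' n' p p' hp hp' => ?_⟩
  rw [numDominoTilings_holeyMixedAztecRectangle ha hc hp,
    numDominoTilings_holeyMixedAztecRectangle ha hc hp']
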